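/- Let $n\ge 2$ and let $\mathbb M^n$ be $n$-dimensional Minkowski space, $\mathcal L_0$ the identity component of $\mathrm O(n-1,1)$, and $\mathcal P_0$ the group of affine bijections of $\mathbb M^n$ with linear part in $\mathcal L_0$ (the Poincaré group). Let $\Omega$ be the set of locally finite subsets of $\mathbb M^n$, with the $\sigma$-algebra generated by the maps $\omega\mapsto|\omega\cap B|$, $B$ Borel, and let $\mu$ be the law on $\Omega$ of the Poisson process of density $\rho>0$: if $B$ is a Borel set of finite volume $V$, then $|\omega\cap B|$ is Poisson distributed with mean $\rho V$, and the numbers of points in pairwise disjoint such sets are independent. The group $\mathcal P_0$ acts on $\mathbb M^n$, on $\Omega$ pointwise, and, through its linear part, on the hyperboloid $\mathcal H$ of future-directed unit timelike vectors, on the hyperboloid $\mathcal S$ of unit spacelike vectors, and on $(\mathcal H\sqcup\mathcal S)^k/\Gamma$, where $k\ge1$ and the group $\Gamma\le \mathfrak S_k$ permutes the entries (with the quotient $\sigma$-algebra). For a measure space $(X,\nu)$ and a measurable space $Y$ on which $\mathcal P_0$ acts, and a subgroup $G\le\mathcal P_0$, say that $(X,\nu)$ *$G$-equivariantly determines a point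 of $Y$* if there are a measurable set $A\subseteq X$ with $\nu(A)\neq0$ and a measurable map $D:A\to Y$ such that $D(gx)=g\,D(x)$ whenever $g\in G$, $x\in A$ and $gx\in A$. (This includes everywhere defined equivariant maps, and equivariant maps defined on an invariant set of nonzero measure.) Then: 1. (No preferred location.) $(\Omega,\mu)$ does not $\mathcal P_0$-equivariantly determine a point of $\mathbb M^n$; it does not do so even when $\mathcal P_0$ is replaced by the subgroup of translations. 2. (The results on directions hold for the Poincaré group as well as for the Lorentz group.) Let $Y$ be $\mathcal H$, or $\mathcal S$, or $(\mathcal H\sqcup\mathcal S)^k/\Gamma$ for some $k\ge1$ and $\Gamma\le\mathfrak S_k$. Then - (a) $(\Omega,\mu)$ does not $\mathcal P_0$-equivariantly determine a point of $Y$; - (b) for every $x\in\mathbb M^n$, $(\Omega,\mu)$ does not $G_x$-equivariantly determine a point of $Y$, where $G_x\cong\mathcal L_0$ is the stabilizer of $x$ in $\mathcal P_0$; - (c) $(\Omega\times\mathbb M^n,\ \mu\otimes\mathrm{vol})$ does not $\mathcal P_0$-equivariantly determine a point of $Y$; that is, there is no rule $(\omega,x)\mapsto D(\omega,x)\in Y$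 for choosing directions at variable points $x$ with $D(g\omega,gx)=g\,D(\omega,x)$. -/

import Mathlib

open MeasureTheory ProbabilityTheory

noncomputable section

namespace Sprinkling

/-- Minkowski space of dimension `d + 1`, in inertial coordinates; coordinate `0` is time. Topology,
Borel sets and the volume measure are the usual ones of `ℝ^(d+1)`. -/
abbrev Minkowski (d : ℕ) : Type := Fin (d + 1) → ℝ

/-- The Minkowski inner product, of signature `(-, +, …, +)`. -/
def eta {d : ℕ} (v w : Minkowski d) : ℝ := -(v 0 * w 0) + ∑ i : Fin d, v i.succ * w i.succ

/-- The full Lorentz group `O(d, 1)`, with the topology of invertible matrices. -/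
def fullLorentz (d : ℕ) : Subgroup (GL (Fin (d + 1)) ℝ) where
  carrier := {L | ∀ v w : Minkowski d,
    eta ((L : Matrix (Fin (d + 1)) (Fin (d + 1)) ℝ).mulVec v)
      ((L : Matrix (Fin (d + 1)) (Fin (d + 1)) ℝ).mulVec w) = eta v w}
  one_mem' := by intro v w; simp
  mul_mem' := by
    intro a b ha hb v w
    simp only [Units.val_mul, ← Matrix.mulVec_mulVec]
    rw [ha, hb]
  inv_mem' := by
    intro a ha v w
    have h := ha ((↑(a⁻¹) : Matrix (Fin (d + 1)) (Fin (d + 1)) ℝ).mulVec v)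
      ((↑(a⁻¹) : Matrix (Fin (d + 1)) (Fin (d + 1)) ℝ).mulVec w)
    simpa only [Matrix.mulVec_mulVec, ← Units.val_mul, mul_inv_cancel, Units.val_one,
      Matrix.one_mulVec] using h.symm

/-- The Lorentz group: the connected component of the identity in `O(d, 1)`. -/
def lorentz (d : ℕ) : Subgroup (GL (Fin (d + 1)) ℝ) :=
  (Subgroup.connectedComponentOfOne (fullLorentz d)).map (fullLorentz d).subtype

theorem eta_lorentz {d : ℕ} {L : GL (Fin (d + 1)) ℝ} (hL : L ∈ lorentz d) (v w : Minkowski d) :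
    eta ((L : Matrix (Fin (d + 1)) (Fin (d + 1)) ℝ).mulVec v)
      ((L : Matrix (Fin (d + 1)) (Fin (d + 1)) ℝ).mulVec w) = eta v w := by
  obtain ⟨M, -, rfl⟩ := hL
  exact M.2 v w

theorem time_ne_zero {d : ℕ} {v : Minkowski d} (hv : eta v v = -1) : v 0 ≠ 0 := by
  intro h
  have : 0 ≤ ∑ i : Fin d, v i.succ * v i.succ := Finset.sum_nonneg fun i _ => mul_self_nonneg _
  simp only [eta, h] at hv
  linarith

/-- Lorentz transformations in the identity component preserve the time orientation. -/
theorem future_lorentz {d : ℕ} {L : GL (Fin (d + 1)) ℝ} (hL : L ∈ lorentz d) {v : Minkowski d}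
    (hv : eta v v = -1) (h0 : 0 < v 0) :
    0 < (L : Matrix (Fin (d + 1)) (Fin (d + 1)) ℝ).mulVec v 0 := by
  obtain ⟨M, hM, rfl⟩ := hL
  let f : fullLorentz d → ℝ := fun N =>
    ((N : GL (Fin (d + 1)) ℝ) : Matrix (Fin (d + 1)) (Fin (d + 1)) ℝ).mulVec v 0
  have hf : Continuous f := by
    have h1 : Continuous fun N : fullLorentz d =>
        ((N : GL (Fin (d + 1)) ℝ) : Matrix (Fin (d + 1)) (Fin (d + 1)) ℝ) :=
      Units.continuous_val.comp continuous_subtype_val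
    exact (continuous_apply 0).comp (h1.matrix_mulVec continuous_const)
  have hne : ∀ N, f N ≠ 0 := fun N => time_ne_zero ((N.2 v v).trans hv)
  have h1 : 0 < f 1 := by simpa [f] using h0
  have hM' : M ∈ connectedComponent (1 : fullLorentz d) := hM
  have hpre := (isPreconnected_connectedComponent (x := (1 : fullLorentz d))).image f
    hf.continuousOn
  by_contra hneg
  have hle : f M ≤ 0 := not_lt.mp hneg
  obtain ⟨N, -, hN⟩ := hpre.ordConnected.out (Set.mem_image_of_mem f hM')
    (Set.mem_image_of_mem f mem_connectedComponent) ⟨hle, h1.le⟩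
  exact hne N hN

/-- The Poincaré group (its identity component): the affine bijections of Minkowski space whose
linear part lies in the Lorentz group. -/
def poincareSubgroup (d : ℕ) : Subgroup (Minkowski d ≃ᵃ[ℝ] Minkowski d) where
  carrier := {g | ∃ L ∈ lorentz d, ∀ v : Minkowski d,
    g.linear v = (L : Matrix (Fin (d + 1)) (Fin (d + 1)) ℝ).mulVec v}
  one_mem' := ⟨1, one_mem _, fun v => by simp [AffineEquiv.one_def]⟩
  mul_mem' := by
    rintro a b ⟨L, hL, hLa⟩ ⟨K, hK, hKb⟩
    refine ⟨L * K, mul_mem hL hK, fun v => ?_⟩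
    have : (a * b).linear v = a.linear (b.linear v) := rfl
    rw [this, hKb, hLa, Units.val_mul, Matrix.mulVec_mulVec]
  inv_mem' := by
    rintro a ⟨L, hL, hLa⟩
    refine ⟨L⁻¹, inv_mem hL, fun v => ?_⟩
    have : (a⁻¹).linear v = a.linear.symm v := rfl
    rw [this, LinearEquiv.symm_apply_eq, hLa, Matrix.mulVec_mulVec, ← Units.val_mul,
      mul_inv_cancel, Units.val_one, Matrix.one_mulVec]

abbrev Poincare (d : ℕ) : Type := poincareSubgroup d

/-- The Poincaré group acts on the points of Minkowski space by affine maps. -/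
instance (d : ℕ) : MulAction (Poincare d) (Minkowski d) where
  smul g x := g.1 x
  one_smul _ := rfl
  mul_smul _ _ _ := rfl

/-- The subgroup of spacetime translations. -/
def translations (d : ℕ) : Subgroup (Poincare d) where
  carrier := {g | ∀ v : Minkowski d, g.1.linear v = v}
  one_mem' := fun _ => rfl
  mul_mem' := by
    intro a b ha hb v
    have : (a * b).1.linear v = a.1.linear (b.1.linear v) := rfl
    rw [this, hb, ha]
  inv_mem' := by
    intro a ha v
    have : (a⁻¹).1.linear v = a.1.linear.symm v := rfl
    rw [this, LinearEquiv.symm_apply_eq, ha]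

/-- The hyperboloid of future-directed unit timelike vectors. -/
def Timelike (d : ℕ) : Type := {v : Minkowski d // eta v v = -1 ∧ 0 < v 0}

/-- The hyperboloid of unit spacelike vectors. -/
def Spacelike (d : ℕ) : Type := {v : Minkowski d // eta v v = 1}

instance (d : ℕ) : MeasurableSpace (Timelike d) := Subtype.instMeasurableSpace

instance (d : ℕ) : MeasurableSpace (Spacelike d) := Subtype.instMeasurableSpace

/-- The Poincaré group acts on directions through its linear part. -/
instance (d : ℕ) : MulAction (Poincare d) (Timelike d) where
  smul g v := ⟨g.1.linear v.1, by
    obtain ⟨L, hL, h⟩ := g.2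
    rw [h]
    exact ⟨(eta_lorentz hL _ _).trans v.2.1, future_lorentz hL v.2.1 v.2.2⟩⟩
  one_smul _ := rfl
  mul_smul _ _ _ := rfl

/-- The Poincaré group acts on directions through its linear part. -/
instance (d : ℕ) : MulAction (Poincare d) (Spacelike d) where
  smul g v := ⟨g.1.linear v.1, by
    obtain ⟨L, hL, h⟩ := g.2
    rw [h]
    exact (eta_lorentz hL _ _).trans v.2⟩
  one_smul _ := rfl
  mul_smul _ _ _ := rfl

/-- Two `k`-tuples of directions, each direction timelike or spacelike, are identified when they
differ by a permutation of the entries that belongs to `S`. -/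
def permSetoid (d : ℕ) {k : ℕ} (S : Subgroup (Equiv.Perm (Fin k))) :
    Setoid (Fin k → Timelike d ⊕ Spacelike d) where
  r v w := ∃ s ∈ S, w = v ∘ s
  iseqv :=
    { refl := fun _ => ⟨1, one_mem _, rfl⟩
      symm := by
        rintro v w ⟨s, hs, rfl⟩
        refine ⟨s⁻¹, inv_mem hs, ?_⟩
        ext1 i
        simp
      trans := by
        rintro u v w ⟨s, hs, rfl⟩ ⟨t, ht, rfl⟩
        exact ⟨s * t, mul_mem hs ht, rfl⟩ }

/-- Families of `k` directions modulo the permutation group `S`, with the quotient σ-algebra. For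
`S = ⊥` these are ordered tuples (such as frames), for `S = ⊤` unordered ones. -/
def Directions (d : ℕ) {k : ℕ} (S : Subgroup (Equiv.Perm (Fin k))) : Type :=
  Quotient (permSetoid d S)

instance (d : ℕ) {k : ℕ} (S : Subgroup (Equiv.Perm (Fin k))) : MeasurableSpace (Directions d S) :=
  Quotient.instMeasurableSpace

instance (d : ℕ) {k : ℕ} (S : Subgroup (Equiv.Perm (Fin k))) :
    MulAction (Poincare d) (Directions d S) where
  smul g := Quotient.map (sa := permSetoid d S) (sb := permSetoid d S) (fun v i => g • v i) (by
    rintro v w ⟨s, hs, rfl⟩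
    exact ⟨s, hs, rfl⟩)
  one_smul := by
    rintro ⟨v⟩
    exact congrArg (Quotient.mk (permSetoid d S)) (funext fun i => one_smul _ (v i))
  mul_smul := by
    rintro a b ⟨v⟩
    exact congrArg (Quotient.mk (permSetoid d S)) (funext fun i => mul_smul a b (v i))

/-- The space `Ω` of possible sprinklings: the locally finite sets of points. -/
def Omega (d : ℕ) : Type :=
  {w : Set (Minkowski d) // ∀ K : Set (Minkowski d), IsCompact K → (w ∩ K).Finite}

/-- The number of sprinkled points in a region. -/
def count {d : ℕ} (B : Set (Minkowski d)) (w : Omega d) : ℕ∞ := (w.1 ∩ B).encard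

/-- The σ-algebra on `Ω` generated by the numbers of points in Borel sets. -/
instance (d : ℕ) : MeasurableSpace (Omega d) :=
  ⨆ (B : Set (Minkowski d)) (_ : MeasurableSet B), MeasurableSpace.comap (count B) ⊤

/-- The Poincaré group acts on sprinklings by moving each of their points. -/
instance (d : ℕ) : MulAction (Poincare d) (Omega d) where
  smul g w := ⟨g.1 '' w.1, by
    intro K hK
    have hc : Continuous (g.1.symm : Minkowski d → Minkowski d) :=
      AffineMap.continuous_of_finiteDimensional g.1.symm.toAffineMap
    refine ((w.2 _ (hK.image hc)).image g.1).subset ?_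
    rintro _ ⟨⟨x, hx, rfl⟩, hxK⟩
    exact ⟨x, ⟨hx, g.1 x, hxK, by simp⟩, rfl⟩⟩
  one_smul w := Subtype.ext (Set.image_id w.1)
  mul_smul a b w := Subtype.ext (Set.image_comp a.1 b.1 w.1)

/-- `μ` is the law of the Poisson process of density `ρ`: the number of points in a Borel set of
finite volume `V` has the Poisson distribution with mean `ρ V`, and the numbers of points in
disjoint such sets are independent. -/
structure IsPoisson {d : ℕ} (ρ : ℝ) (μ : Measure (Omega d)) : Prop where
  isProbabilityMeasure : IsProbabilityMeasure μ
  count_eq : ∀ B : Set (Minkowski d), MeasurableSet B → volume B ≠ ⊤ → ∀ k : ℕ,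
    μ {w | count B w = k} = ENNReal.ofReal
      ((ρ * (volume B).toReal) ^ k * Real.exp (-(ρ * (volume B).toReal)) / (k.factorial : ℝ))
  indep : ∀ (m : ℕ) (B : Fin m → Set (Minkowski d)), (∀ i, MeasurableSet (B i)) →
    (∀ i, volume (B i) ≠ ⊤) → Pairwise (fun i j => Disjoint (B i) (B j)) →
    iIndepFun (fun i => count (B i)) μ

/-- Some `G`-equivariant measurable rule, defined at least on a set `A` of nonzero measure, assigns
elements of `Y` to elements of `X`. It is only asked to commute with those transformations that do
not lead out of `A`; if `A` is `G`-invariant, in particular if `A` is everything, this is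
equivariance in the full sense. -/
def Determines {d : ℕ} {X : Type} [MeasurableSpace X] [MulAction (Poincare d) X] (ν : Measure X)
    (G : Subgroup (Poincare d)) (Y : Type) [MeasurableSpace Y] [MulAction (Poincare d) Y] : Prop :=
  ∃ A : Set X, MeasurableSet A ∧ ν A ≠ 0 ∧ ∃ D : A → Y, Measurable D ∧
    ∀ g ∈ G, ∀ (x : X) (hx : x ∈ A) (hgx : g • x ∈ A), D ⟨g • x, hgx⟩ = g • D ⟨x, hx⟩

end Sprinkling

end

open Sprinkling

/-! The proof is Poincaré recurrence. If a transformation preserves a finite measure and a function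
`q` is multiplied by a constant `c > 1` along its orbits, then the integer part of `log_c |q|`
strictly increases along them, so that a point with `q ≠ 0` cannot return to its own level: `q`
vanishes almost everywhere. An equivariant rule `D` pulls such functions back from `Y`. For
locations take `exp (x⁰)` and a translation in time. For families of directions take the sum of
`|v⁰ ± vⁱ|` over the family, which the boosts along the `i`-th axis multiply by `e^{± s}`; for every
family one of these finitely many sums is nonzero.

The Poisson process is invariant because the void probabilities `exp (-ρ vol B)` determine its law
(Rényi) and Lorentz transformations preserve the volume. -/

noncomputable section

namespace Sprinkling

open TopologicalSpace Function
open scoped Matrix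

/-! ### Recurrence -/

theorem ae_eq_zero_of_iterate_eq_pow_mul {X : Type*} [MeasurableSpace X] {ν : Measure X}
    {f : X → X} (hf : Conservative f ν) {c : ℝ} (hc : 1 < c) {q : X → ℝ} (hq : AEMeasurable q ν)
    (hscale : ∀ x n, q x ≠ 0 → q (f^[n] x) ≠ 0 → q (f^[n] x) = c ^ n * q x) :
    q =ᵐ[ν] 0 := by
  let level (j : ℤ) : Set X := {x | q x ≠ 0 ∧ ⌊Real.logb c (q x)⌋ = j}
  have level_measurable (j : ℤ) : NullMeasurableSet (level j) ν := by
    have hS : MeasurableSet {r : ℝ | r ≠ 0 ∧ ⌊Real.logb c r⌋ = j} :=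
      (measurableSet_singleton 0).compl.inter
        ((Real.measurable_log.div_const _).floor (measurableSet_singleton j))
    exact hq.nullMeasurable hS
  have level_null (j : ℤ) : ν (level j) = 0 := by
    by_contra hpos
    obtain ⟨x, ⟨hx, hxj⟩, n, hn, hfx, hfxj⟩ := hf.exists_mem_iterate_mem (level_measurable j) hpos
    have hlog : Real.logb c (q (f^[n] x)) = Real.logb c (q x) + n := by
      rw [hscale x n hx hfx, Real.logb_mul (by positivity) hx, Real.logb_pow,
        Real.logb_self_eq_one hc, mul_one, add_comm]
    rw [hlog, Int.floor_add_natCast, hxj] at hfxj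
    omega
  refine measure_mono_null (fun x hx => ?_) (measure_iUnion_null level_null)
  exact Set.mem_iUnion.2 ⟨_, hx, rfl⟩

section Determines

variable {d : ℕ} {X : Type} [MeasurableSpace X] [MulAction (Poincare d) X] {ν : Measure X}
  {G : Subgroup (Poincare d)} {Y : Type} [MeasurableSpace Y] [MulAction (Poincare d) Y]

theorem not_determines_of_scaling {κ : Type*} [Countable κ] {g : κ → Poincare d}
    (hg : ∀ a, g a ∈ G) (hcons : ∀ a, Conservative (fun x : X => g a • x) ν) {c : ℝ} (hc : 1 < c)
    {Q : κ → Y → ℝ} (hQ : ∀ a, Measurable (Q a)) (hscale : ∀ a y, Q a (g a • y) = c * Q a y)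
    (hne : ∀ y, ∃ a, Q a y ≠ 0) : ¬ Determines ν G Y := by
  classical
  rintro ⟨A, hA, hνA, D, hD, hequiv⟩
  let q (a : κ) (x : X) : ℝ := if hx : x ∈ A then Q a (D ⟨x, hx⟩) else 0
  have q_measurable (a : κ) : Measurable (q a) :=
    Measurable.dite ((hQ a).comp hD) measurable_const hA
  have hscale_pow (a : κ) (n : ℕ) (y : Y) : Q a (g a ^ n • y) = c ^ n * Q a y := by
    induction n with
    | zero => simp
    | succ n ih => rw [pow_succ', mul_smul, hscale, ih, pow_succ', mul_assoc]
  have q_null (a : κ) : q a =ᵐ[ν] 0 := by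
    refine ae_eq_zero_of_iterate_eq_pow_mul (hcons a) hc (q_measurable a).aemeasurable
      fun x n hx hgx => ?_
    rw [smul_iterate_apply] at hgx ⊢
    have hxA : x ∈ A := by_contra fun h => hx (dif_neg h)
    have hgxA : g a ^ n • x ∈ A := by_contra fun h => hgx (dif_neg h)
    simp only [q, dif_pos hxA, dif_pos hgxA, hequiv _ (pow_mem (hg a) n) x hxA hgxA, hscale_pow]
  refine hνA (measure_eq_zero_iff_ae_notMem.2 ?_)
  filter_upwards [ae_all_iff.2 q_null] with x hx hxA
  obtain ⟨a, ha⟩ := hne (D ⟨x, hxA⟩)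
  exact ha (by simpa only [q, dif_pos hxA, Pi.zero_apply] using hx a)

theorem Determines.map {Z : Type} [MeasurableSpace Z] [MulAction (Poincare d) Z]
    (h : Determines ν G Y) {φ : Y → Z} (hφ : Measurable φ)
    (hequiv : ∀ g ∈ G, ∀ y, φ (g • y) = g • φ y) : Determines ν G Z := by
  obtain ⟨A, hA, hνA, D, hD, hDequiv⟩ := h
  exact ⟨A, hA, hνA, φ ∘ D, hφ.comp hD, fun g hg x hx hgx => by
    rw [comp_apply, hDequiv g hg x hx hgx, hequiv g hg, comp_apply]⟩

theorem Determines.exists_inf_stabilizer [SFinite ν] {Z : Type} [MeasurableSpace Z]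
    [MulAction (Poincare d) Z] {κ : Measure Z} [SFinite κ] (h : Determines (ν.prod κ) G Y) :
    ∃ z : Z, Determines ν (G ⊓ MulAction.stabilizer (Poincare d) z) Y := by
  obtain ⟨A, hA, hνA, D, hD, hequiv⟩ := h
  obtain ⟨z, hz⟩ : ∃ z, ν ((fun x => (x, z)) ⁻¹' A) ≠ 0 := by
    by_contra! hnull
    exact hνA (by simp [Measure.prod_apply_symm hA, hnull])
  refine ⟨z, (fun x => (x, z)) ⁻¹' A, measurable_prodMk_right hA, hz, fun x => D ⟨(x, z), x.2⟩,
    hD.comp (measurable_prodMk_right.comp measurable_subtype_coe).subtype_mk, ?_⟩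
  rintro g ⟨hgG, hgz⟩ x hx hgx
  have hpair : g • (x, z) = (g • x, z) := Prod.ext rfl hgz
  rw [← hequiv g hgG (x, z) hx (by rwa [hpair])]
  exact congrArg D (Subtype.ext hpair.symm)

end Determines

/-! ### Invariance of the volume and of the Poisson process -/

section Invariance

variable {d : ℕ}

theorem det_sq_eq_one_of_transpose_mul_mul {n R : Type*} [Fintype n] [DecidableEq n] [CommRing R]
    {M J : Matrix n n R} (hJ : IsRegular J.det) (h : Mᵀ * J * M = J) : M.det ^ 2 = 1 := by
  have hdet : M.det * J.det * M.det = J.det := by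
    simpa only [Matrix.det_mul, Matrix.det_transpose] using congrArg Matrix.det h
  apply hJ.right
  linear_combination hdet

/-- The Gram matrix of the Minkowski inner product in inertial coordinates. -/
def etaMatrix (d : ℕ) : Matrix (Fin (d + 1)) (Fin (d + 1)) ℝ :=
  Matrix.diagonal (Fin.cons (-1) fun _ => 1)

theorem eta_eq_dotProduct (v w : Minkowski d) : eta v w = v ⬝ᵥ etaMatrix d *ᵥ w := by
  simp [eta, etaMatrix, dotProduct, Fin.sum_univ_succ, Matrix.mulVec_diagonal]

theorem det_etaMatrix : (etaMatrix d).det = -1 := by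
  simp [etaMatrix, Matrix.det_diagonal, Fin.prod_univ_succ]

theorem transpose_mul_etaMatrix_mul {L : GL (Fin (d + 1)) ℝ} (hL : L ∈ fullLorentz d) :
    (L : Matrix (Fin (d + 1)) (Fin (d + 1)) ℝ)ᵀ * etaMatrix d * L = etaMatrix d := by
  refine Matrix.ext_of_mulVec_single fun j => dotProduct_eq _ _ fun v => ?_
  rw [dotProduct_comm, dotProduct_comm _ v, ← eta_eq_dotProduct, ← hL, eta_eq_dotProduct,
    ← Matrix.mulVec_mulVec, ← Matrix.mulVec_mulVec, Matrix.dotProduct_mulVec,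
    Matrix.vecMul_transpose]

theorem abs_det_eq_one_of_mem_fullLorentz {L : GL (Fin (d + 1)) ℝ} (hL : L ∈ fullLorentz d) :
    |(L : Matrix (Fin (d + 1)) (Fin (d + 1)) ℝ).det| = 1 := by
  rw [← sq_eq_sq₀ (abs_nonneg _) zero_le_one, sq_abs, one_pow]
  refine det_sq_eq_one_of_transpose_mul_mul (IsRegular.of_ne_zero ?_)
    (transpose_mul_etaMatrix_mul hL)
  simp [det_etaMatrix]

theorem exists_smul_eq_mulVec_add (g : Poincare d) : ∃ L ∈ lorentz d, ∀ v : Minkowski d,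
    g • v = (L : Matrix (Fin (d + 1)) (Fin (d + 1)) ℝ) *ᵥ v + g • (0 : Minkowski d) := by
  obtain ⟨L, hL, hLg⟩ := g.2
  refine ⟨L, hL, fun v => ?_⟩
  have hvadd : g • (v + 0) = g.1.linear v + g • (0 : Minkowski d) := g.1.map_vadd 0 v
  rwa [add_zero, hLg] at hvadd

instance : ContinuousConstSMul (Poincare d) (Minkowski d) where
  continuous_const_smul g := AffineMap.continuous_of_finiteDimensional g.1.toAffineMap

instance : SMulInvariantMeasure (Poincare d) (Minkowski d) volume where
  measure_preimage_smul g B _ := by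
    obtain ⟨_, ⟨L, -, rfl⟩, hL⟩ := exists_smul_eq_mulVec_add g
    set M := ((L : GL (Fin (d + 1)) ℝ) : Matrix (Fin (d + 1)) (Fin (d + 1)) ℝ)
    have habs : |(Matrix.toLin' M).det| = 1 := by
      rw [LinearMap.det_toLin']
      exact abs_det_eq_one_of_mem_fullLorentz L.2
    have hdet : (Matrix.toLin' M).det ≠ 0 := abs_ne_zero.1 (habs.trans_ne one_ne_zero)
    have hg : (fun v : Minkowski d => g • v) = (· + g • (0 : Minkowski d)) ∘ Matrix.toLin' M :=
      funext hL
    rw [hg, Set.preimage_comp, Measure.addHaar_preimage_linearMap volume hdet, abs_inv, habs,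
      inv_one, ENNReal.ofReal_one, one_mul, measure_preimage_add_right]

theorem measurable_count {B : Set (Minkowski d)} (hB : MeasurableSet B) :
    Measurable (count B) :=
  measurable_iff_comap_le.2 <|
    le_iSup₂ (f := fun (B : Set (Minkowski d)) (_ : MeasurableSet B) =>
      MeasurableSpace.comap (count B) ⊤) B hB

theorem measurable_omega_iff {Ω : Type*} [MeasurableSpace Ω] {f : Ω → Omega d} :
    Measurable f ↔ ∀ B, MeasurableSet B → Measurable (count B ∘ f) := by
  refine ⟨fun hf B hB => (measurable_count hB).comp hf, fun h => measurable_iff_comap_le.2 ?_⟩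
  simp only [instMeasurableSpaceOmega, MeasurableSpace.comap_iSup, MeasurableSpace.comap_comp]
  exact iSup₂_le fun B hB => measurable_iff_comap_le.1 (h B hB)

theorem count_smul (g : Poincare d) (B : Set (Minkowski d)) (w : Omega d) :
    count B (g • w) = count ((g • ·) ⁻¹' B) w := by
  change (g.1 '' w.1 ∩ B).encard = (w.1 ∩ g.1 ⁻¹' B).encard
  rw [← Set.image_inter_preimage, g.1.injective.encard_image]

instance : MeasurableConstSMul (Poincare d) (Omega d) where
  measurable_const_smul g := measurable_omega_iff.2 fun B hB => by
    rw [show count B ∘ (g • ·) = count ((g • ·) ⁻¹' B) from funext (count_smul g B)]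
    exact measurable_count (measurable_const_smul g hB)

theorem le_encard_iff_exists_pairwise_disjoint {T : Type*} [TopologicalSpace T] [T2Space T]
    {𝒰 : Set (Set T)} (h𝒰 : IsTopologicalBasis 𝒰) {A : Set T} {n : ℕ} :
    (n : ℕ∞) ≤ A.encard ↔
      ∃ U : Fin n → 𝒰, Pairwise (Disjoint on fun i => (U i : Set T)) ∧
        ∀ i, (A ∩ U i).Nonempty := by
  constructor
  · intro h
    obtain ⟨t, htA, htn⟩ := Set.exists_subset_encard_eq h
    lift t to Finset T using Set.finite_of_encard_eq_coe htn
    rw [Set.encard_coe_eq_coe_finsetCard, Nat.cast_inj] at htn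
    obtain ⟨V, hV, hdisj⟩ := t.finite_toSet.t2_separation
    let x (i : Fin n) : t := (t.equivFinOfCardEq htn).symm i
    choose U hU hxU hUV using fun i =>
      h𝒰.exists_subset_of_mem_open (hV (x i)).1 (hV (x i)).2
    refine ⟨fun i => ⟨U i, hU i⟩, fun i j hij => ?_, fun i => ⟨x i, htA (x i).2, hxU i⟩⟩
    have hx : (x i : T) ≠ x j := fun h => hij ((Equiv.injective _) (Subtype.ext h))
    exact (hdisj (x i).2 (x j).2 hx).mono (hUV i) (hUV j)
  · rintro ⟨U, hdisj, hU⟩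
    choose x hxA hxU using hU
    have hx : Injective x := fun i j hij => by_contra fun hne =>
      Set.disjoint_left.1 (hdisj hne) (hxU i) (hij ▸ hxU j)
    calc (n : ℕ∞) = (Set.range x).encard := by simp [← Set.image_univ, hx.encard_image]
      _ ≤ A.encard := Set.encard_le_encard (Set.range_subset_iff.2 hxA)

/-- The events that a Borel set of finite volume contains no sprinkled point. Their probabilities
determine the law of a random sprinkling. -/
def voidEvents (d : ℕ) : Set (Set (Omega d)) :=
  {S | ∃ B : Set (Minkowski d), MeasurableSet B ∧ volume B ≠ ⊤ ∧ S = {w | count B w = 0}}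

theorem isPiSystem_voidEvents : IsPiSystem (voidEvents d) := by
  rintro _ ⟨B, hB, hBfin, rfl⟩ _ ⟨C, hC, hCfin, rfl⟩ -
  refine ⟨B ∪ C, hB.union hC, measure_union_ne_top hBfin hCfin, ?_⟩
  ext w
  simp [count, Set.inter_union_distrib_left]

theorem measurableSet_generateFrom_voidEvents_le_count {B : Set (Minkowski d)}
    (hB : MeasurableSet B) (n : ℕ) :
    MeasurableSet[MeasurableSpace.generateFrom (voidEvents d)] {w | (n : ℕ∞) ≤ count B w} := by
  obtain ⟨𝒰, hfin, hcount, h𝒰⟩ :=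
    (volume : Measure (Minkowski d)).isTopologicalBasis_isOpen_lt_top.exists_countable
  have := hcount.to_subtype
  have hunion : {w : Omega d | (n : ℕ∞) ≤ count B w} =
      ⋃ (U : Fin n → 𝒰) (_ : Pairwise (Disjoint on fun i => (U i : Set (Minkowski d)))),
        ⋂ i, {w : Omega d | count (B ∩ U i) w = 0}ᶜ := by
    ext w
    simp only [count, le_encard_iff_exists_pairwise_disjoint h𝒰, Set.mem_ofPred_eq,
      Set.mem_iUnion, Set.mem_iInter, Set.mem_compl_iff, Set.encard_eq_zero, exists_prop,
      Set.nonempty_iff_ne_empty, Set.inter_assoc, ne_eq]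
  rw [hunion]
  refine MeasurableSet.iUnion fun U => MeasurableSet.iUnion fun _ => MeasurableSet.iInter fun i =>
    MeasurableSet.compl (MeasurableSpace.measurableSet_generateFrom ?_)
  obtain ⟨hopen, hlt⟩ := hfin (U i).2
  exact ⟨_, hB.inter hopen.measurableSet,
    measure_ne_top_of_subset Set.inter_subset_right hlt.ne, rfl⟩

theorem measurableSpace_omega_eq_generateFrom_voidEvents :
    instMeasurableSpaceOmega d = MeasurableSpace.generateFrom (voidEvents d) := by
  apply le_antisymm
  · refine iSup₂_le fun B hB => measurable_iff_comap_le.1 ?_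
    refine (@ENat.measurable_iff _ (MeasurableSpace.generateFrom (voidEvents d)) _).2 fun n => ?_
    have hlevel : count B ⁻¹' {(n : ℕ∞)} =
        {w | (n : ℕ∞) ≤ count B w} \ {w | ((n + 1 : ℕ) : ℕ∞) ≤ count B w} := by
      ext w
      have hsucc : ((n + 1 : ℕ) : ℕ∞) ≤ count B w ↔ (n : ℕ∞) < count B w := by
        rw [Nat.cast_add_one, ENat.add_one_le_iff (ENat.natCast_ne_top n)]
      rw [Set.mem_sdiff, Set.mem_ofPred_eq, Set.mem_ofPred_eq, hsucc, not_lt]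
      exact eq_comm.trans le_antisymm_iff
    rw [hlevel]
    exact (measurableSet_generateFrom_voidEvents_le_count hB n).diff
      (measurableSet_generateFrom_voidEvents_le_count hB (n + 1))
  · refine MeasurableSpace.generateFrom_le ?_
    rintro _ ⟨B, hB, -, rfl⟩
    exact measurable_count hB (measurableSet_singleton 0)

theorem ext_of_count_eq_zero {μ μ' : Measure (Omega d)} [IsFiniteMeasure μ]
    (h : ∀ B, MeasurableSet B → volume B ≠ ⊤ → μ {w | count B w = 0} = μ' {w | count B w = 0}) :
    μ = μ' := by
  refine ext_of_generate_finite (voidEvents d) measurableSpace_omega_eq_generateFrom_voidEvents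
    isPiSystem_voidEvents ?_ ?_
  · rintro _ ⟨B, hB, hBfin, rfl⟩
    exact h B hB hBfin
  · simpa [count] using h ∅ .empty (by simp)

theorem IsPoisson.measure_count_eq_zero {ρ : ℝ} {μ : Measure (Omega d)} (hμ : IsPoisson ρ μ)
    {B : Set (Minkowski d)} (hB : MeasurableSet B) (hBfin : volume B ≠ ⊤) :
    μ {w | count B w = 0} = ENNReal.ofReal (Real.exp (-(ρ * (volume B).toReal))) := by
  simpa using hμ.count_eq B hB hBfin 0

theorem IsPoisson.smulInvariantMeasure {ρ : ℝ} {μ : Measure (Omega d)} (hμ : IsPoisson ρ μ) :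
    SMulInvariantMeasure (Poincare d) (Omega d) μ := by
  have := hμ.isProbabilityMeasure
  have hmap (g : Poincare d) : μ.map (g • ·) = μ := by
    refine (ext_of_count_eq_zero fun B hB hBfin => ?_).symm
    have hpre : MeasurableSet ((g • ·) ⁻¹' B) := measurable_const_smul g hB
    have hvol : volume ((g • ·) ⁻¹' B) = volume B := measure_preimage_smul volume g B
    have hvoid : (g • ·) ⁻¹' {w | count B w = 0} = {w | count ((g • ·) ⁻¹' B) w = 0} :=
      Set.ext fun w => by rw [Set.mem_preimage, Set.mem_ofPred_eq, count_smul, Set.mem_ofPred_eq]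
    have hmeas : MeasurableSet {w | count B w = 0} :=
      measurable_count hB (measurableSet_singleton 0)
    rw [Measure.map_apply (measurable_const_smul g) hmeas, hvoid,
      hμ.measure_count_eq_zero hB hBfin, hμ.measure_count_eq_zero hpre (hvol.trans_ne hBfin), hvol]
  exact ⟨fun g S hS => by rw [← Measure.map_apply (measurable_const_smul g) hS, hmap]⟩

end Invariance

/-! ### Locations -/

section Locations

variable {d : ℕ}

/-- The translation by the vector `a`, as an element of the Poincaré group. -/
def translation (a : Minkowski d) : Poincare d :=
  ⟨AffineEquiv.constVAdd ℝ (Minkowski d) a, 1, one_mem _, fun v => by simp⟩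

theorem translation_mem_translations (a : Minkowski d) : translation a ∈ translations d :=
  fun _ => rfl

theorem translation_smul (a x : Minkowski d) : translation a • x = a + x := rfl

theorem not_determines_location {X : Type} [MeasurableSpace X] [MulAction (Poincare d) X]
    [MeasurableConstSMul (Poincare d) X] {ν : Measure X} [IsFiniteMeasure ν]
    [SMulInvariantMeasure (Poincare d) X ν] {G : Subgroup (Poincare d)} (hG : translations d ≤ G) :
    ¬ Determines ν G (Minkowski d) := by
  refine not_determines_of_scaling (κ := Unit) (g := fun _ => translation (Pi.single 0 1))
    (Q := fun _ x => Real.exp (x 0)) (fun _ => hG (translation_mem_translations _))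
    (fun _ => (measurePreserving_smul _ ν).conservative) (Real.one_lt_exp_iff.2 one_pos)
    (fun _ => (measurable_pi_apply 0).exp) (fun _ x => ?_) fun x => ⟨(), Real.exp_ne_zero _⟩
  rw [translation_smul, Pi.add_apply, Pi.single_eq_same, Real.exp_add]

end Locations

/-! ### Directions -/

section Boosts

variable {d : ℕ}

/-- The Lorentz transformation `L` about the event `x`: the element of the Poincaré group that fixes
`x` and has linear part `L`. -/
def lorentzAbout (x : Minkowski d) (L : lorentz d) : Poincare d :=
  ⟨AffineEquiv.mk' (fun p => (L.1 : Matrix (Fin (d + 1)) (Fin (d + 1)) ℝ) *ᵥ (p - x) + x)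
      (Matrix.toLin'OfInv L.1.inv_val L.1.val_inv) x
      (fun p => by simp only [sub_self, Matrix.mulVec_zero, zero_add]; rfl),
    L, L.2, fun _ => rfl⟩

theorem lorentzAbout_linear (x : Minkowski d) (L : lorentz d) (v : Minkowski d) :
    (lorentzAbout x L).1.linear v = (L.1 : Matrix (Fin (d + 1)) (Fin (d + 1)) ℝ) *ᵥ v := rfl

theorem lorentzAbout_mem_stabilizer (x : Minkowski d) (L : lorentz d) :
    lorentzAbout x L ∈ MulAction.stabilizer (Poincare d) x := by
  change (L.1 : Matrix (Fin (d + 1)) (Fin (d + 1)) ℝ) *ᵥ (x - x) + x = x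
  simp

/-- The matrix of the boost of rapidity `s` along the `i`-th space axis. -/
def boostMatrix (i : Fin d) (s : ℝ) : Matrix (Fin (d + 1)) (Fin (d + 1)) ℝ :=
  1 + ((Real.cosh s - 1) • (Matrix.single 0 0 1 + Matrix.single i.succ i.succ 1) +
    Real.sinh s • (Matrix.single 0 i.succ 1 + Matrix.single i.succ 0 1))

theorem boostMatrix_mulVec_zero (i : Fin d) (s : ℝ) (v : Minkowski d) :
    (boostMatrix i s *ᵥ v) 0 = Real.cosh s * v 0 + Real.sinh s * v i.succ := by
  simp only [boostMatrix, smul_add, Matrix.smul_single, smul_eq_mul, mul_one, Matrix.add_mulVec,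
    Matrix.one_mulVec, Matrix.single_mulVec, Pi.add_apply, update, Pi.zero_apply, ↓reduceDIte,
    (Fin.succ_ne_zero i).symm, add_zero]
  ring

theorem boostMatrix_mulVec_succ_self (i : Fin d) (s : ℝ) (v : Minkowski d) :
    (boostMatrix i s *ᵥ v) i.succ = Real.sinh s * v 0 + Real.cosh s * v i.succ := by
  simp only [boostMatrix, smul_add, Matrix.smul_single, smul_eq_mul, mul_one, Matrix.add_mulVec,
    Matrix.one_mulVec, Matrix.single_mulVec, Pi.add_apply, update, Pi.zero_apply, ↓reduceDIte,
    Fin.succ_ne_zero, zero_add]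
  ring

theorem boostMatrix_mulVec_succ_of_ne {i j : Fin d} (hji : j ≠ i) (s : ℝ) (v : Minkowski d) :
    (boostMatrix i s *ᵥ v) j.succ = v j.succ := by
  simp [boostMatrix, Matrix.add_mulVec, Matrix.single_mulVec, Function.update, hji]

theorem boostMatrix_zero (i : Fin d) : boostMatrix i 0 = 1 := by
  simp [boostMatrix]

theorem boostMatrix_add (i : Fin d) (s t : ℝ) :
    boostMatrix i (s + t) = boostMatrix i s * boostMatrix i t := by
  refine Matrix.ext_of_mulVec_single fun l => ?_
  rw [← Matrix.mulVec_mulVec]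
  generalize (Pi.single l 1 : Minkowski d) = v
  funext j
  cases j using Fin.cases with
  | zero =>
    simp only [boostMatrix_mulVec_zero, boostMatrix_mulVec_succ_self, Real.cosh_add, Real.sinh_add]
    ring
  | succ j =>
    rcases eq_or_ne j i with rfl | hji
    · simp only [boostMatrix_mulVec_zero, boostMatrix_mulVec_succ_self, Real.cosh_add,
        Real.sinh_add]
      ring
    · simp only [boostMatrix_mulVec_succ_of_ne hji]

theorem continuous_boostMatrix (i : Fin d) : Continuous (boostMatrix i) := by
  unfold boostMatrix
  fun_prop

theorem eta_boostMatrix (i : Fin d) (s : ℝ) (v w : Minkowski d) :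
    eta (boostMatrix i s *ᵥ v) (boostMatrix i s *ᵥ w) = eta v w := by
  have hrest : ∑ j ∈ Finset.univ.erase i,
        (boostMatrix i s *ᵥ v) j.succ * (boostMatrix i s *ᵥ w) j.succ =
      ∑ j ∈ Finset.univ.erase i, v j.succ * w j.succ :=
    Finset.sum_congr rfl fun j hj => by
      simp only [boostMatrix_mulVec_succ_of_ne (Finset.ne_of_mem_erase hj)]
  simp only [eta, ← Finset.add_sum_erase _ _ (Finset.mem_univ i), hrest, boostMatrix_mulVec_zero,
    boostMatrix_mulVec_succ_self]
  linear_combination (v i.succ * w i.succ - v 0 * w 0) * Real.cosh_sq_sub_sinh_sq s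

/-- The boost of rapidity `s` along the `i`-th space axis, as an element of `O(d, 1)`. -/
def boostFullLorentz (i : Fin d) (s : ℝ) : fullLorentz d :=
  ⟨{ val := boostMatrix i s
     inv := boostMatrix i (-s)
     val_inv := by rw [← boostMatrix_add, add_neg_cancel, boostMatrix_zero]
     inv_val := by rw [← boostMatrix_add, neg_add_cancel, boostMatrix_zero] },
    eta_boostMatrix i s⟩

theorem continuous_boostFullLorentz (i : Fin d) : Continuous (boostFullLorentz i) :=
  have hGL : Continuous fun s => (boostFullLorentz i s).1 := Units.continuous_iff.2
    ⟨continuous_boostMatrix i, (continuous_boostMatrix i).comp continuous_neg⟩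
  hGL.subtype_mk _

theorem boostFullLorentz_mem_connectedComponent (i : Fin d) (s : ℝ) :
    boostFullLorentz i s ∈ connectedComponent (1 : fullLorentz d) :=
  have h0 : boostFullLorentz i 0 = 1 := Subtype.ext (Units.ext (boostMatrix_zero i))
  (isPreconnected_range (continuous_boostFullLorentz i)).subset_connectedComponent
    ⟨0, h0⟩ ⟨s, rfl⟩

/-- The boost of rapidity `s` along the `i`-th space axis, as an element of the Lorentz group. -/
def boost (i : Fin d) (s : ℝ) : lorentz d :=
  ⟨boostFullLorentz i s, _, boostFullLorentz_mem_connectedComponent i s, rfl⟩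

/-- The null coordinate `v⁰ + ε vⁱ` of a vector, for a sign `ε`. Boosts along the `i`-th axis
multiply it by a constant. -/
def nullCoord (i : Fin d) (ε : ℤˣ) (v : Minkowski d) : ℝ := v 0 + (ε : ℤ) * v i.succ

theorem measurable_nullCoord (i : Fin d) (ε : ℤˣ) : Measurable (nullCoord i ε) := by
  unfold nullCoord
  fun_prop

theorem nullCoord_boost (i : Fin d) (ε : ℤˣ) (s : ℝ) (v : Minkowski d) :
    nullCoord i ε (((boost i s).1 : Matrix (Fin (d + 1)) (Fin (d + 1)) ℝ) *ᵥ v) =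
      Real.exp ((ε : ℤ) * s) * nullCoord i ε v := by
  change nullCoord i ε (boostMatrix i s *ᵥ v) = _
  rw [nullCoord, boostMatrix_mulVec_zero, boostMatrix_mulVec_succ_self, nullCoord]
  rcases Int.units_eq_one_or ε with rfl | rfl
  · rw [Units.val_one, Int.cast_one, one_mul, one_mul, one_mul, ← Real.cosh_add_sinh]
    ring
  · rw [Units.val_neg, Units.val_one, Int.cast_neg, Int.cast_one, neg_one_mul s,
      ← Real.cosh_sub_sinh]
    ring

theorem exists_nullCoord_ne_zero (hd : 1 ≤ d) {v : Minkowski d} (hv : v ≠ 0) :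
    ∃ i ε, nullCoord i ε v ≠ 0 := by
  by_contra! hnull
  have hcoord (i : Fin d) : v 0 = 0 ∧ v i.succ = 0 := by
    have hplus : v 0 + v i.succ = 0 := by simpa [nullCoord] using hnull i 1
    have hminus : v 0 - v i.succ = 0 := by simpa [nullCoord, sub_eq_add_neg] using hnull i (-1)
    constructor <;> linarith
  exact hv (funext fun j => Fin.cases (hcoord ⟨0, hd⟩).1 (fun i => (hcoord i).2) j)

end Boosts

section Directions

variable {d k : ℕ} {S : Subgroup (Equiv.Perm (Fin k))}

/-- The vector in Minkowski space that a timelike or spacelike direction is. -/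
def directionVector : Timelike d ⊕ Spacelike d → Minkowski d :=
  Sum.elim Subtype.val Subtype.val

theorem measurable_directionVector : Measurable (directionVector (d := d)) :=
  measurable_subtype_coe.sumElim measurable_subtype_coe

theorem directionVector_smul (g : Poincare d) (v : Timelike d ⊕ Spacelike d) :
    directionVector (g • v) = g.1.linear (directionVector v) := by
  cases v <;> rfl

theorem directionVector_ne_zero (v : Timelike d ⊕ Spacelike d) : directionVector v ≠ 0 := by
  have heta : eta (directionVector v) (directionVector v) ≠ 0 := by
    rcases v with v | v
    · exact v.2.1.trans_ne (by norm_num)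
    · exact v.2.trans_ne one_ne_zero
  contrapose! heta
  simp [heta, eta]

/-- The sum of the absolute values `|v⁰ + ε vⁱ|` over a family of directions `v`. -/
def nullSum (i : Fin d) (ε : ℤˣ) : Directions d S → ℝ :=
  Quotient.lift (s := permSetoid d S) (fun v => ∑ j, |nullCoord i ε (directionVector (v j))|) (by
    rintro v _ ⟨s, -, rfl⟩
    exact (Equiv.sum_comp s fun j => |nullCoord i ε (directionVector (v j))|).symm)

theorem measurable_nullSum (i : Fin d) (ε : ℤˣ) : Measurable (nullSum (S := S) i ε) := by
  refine measurable_from_quotient.2 ?_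
  change Measurable fun v : Fin k → Timelike d ⊕ Spacelike d =>
    ∑ j, |nullCoord i ε (directionVector (v j))|
  refine Finset.measurable_fun_sum _ fun j _ => ?_
  exact ((measurable_nullCoord i ε).comp
    (measurable_directionVector.comp (measurable_pi_apply j))).abs

theorem nullSum_boost_smul (x : Minkowski d) (i : Fin d) (ε : ℤˣ) (s : ℝ) (y : Directions d S) :
    nullSum i ε (lorentzAbout x (boost i s) • y) = Real.exp ((ε : ℤ) * s) * nullSum i ε y := by
  obtain ⟨v⟩ := y
  change ∑ j, |nullCoord i ε (directionVector (lorentzAbout x (boost i s) • v j))| =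
    Real.exp ((ε : ℤ) * s) * ∑ j, |nullCoord i ε (directionVector (v j))|
  simp only [directionVector_smul, lorentzAbout_linear, nullCoord_boost, abs_mul, Real.abs_exp,
    Finset.mul_sum]

theorem exists_nullSum_ne_zero (hd : 1 ≤ d) (hk : 1 ≤ k) (y : Directions d S) :
    ∃ i ε, nullSum i ε y ≠ 0 := by
  obtain ⟨v⟩ := y
  obtain ⟨i, ε, hne⟩ := exists_nullCoord_ne_zero hd (directionVector_ne_zero (v ⟨0, hk⟩))
  refine ⟨i, ε, (Finset.sum_pos' (fun _ _ => abs_nonneg _) ⟨⟨0, hk⟩, ?_⟩).ne'⟩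
  exact ⟨Finset.mem_univ _, abs_pos.2 hne⟩

/-- The family that consists of a single direction. -/
def singleDirection (v : Timelike d ⊕ Spacelike d) :
    Directions d (⊤ : Subgroup (Equiv.Perm (Fin 1))) :=
  Quotient.mk (permSetoid d ⊤) fun _ => v

theorem measurable_singleDirection : Measurable (singleDirection (d := d)) :=
  measurable_quotient_mk''.comp (measurable_pi_lambda _ fun _ => measurable_id)

variable {X : Type} [MeasurableSpace X] [MulAction (Poincare d) X] {ν : Measure X}
  {G : Subgroup (Poincare d)}

theorem Determines.directions_of_timelike (h : Determines ν G (Timelike d)) :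
    Determines ν G (Directions d (⊤ : Subgroup (Equiv.Perm (Fin 1)))) :=
  h.map (measurable_singleDirection.comp measurable_inl) fun _ _ _ => rfl

theorem Determines.directions_of_spacelike (h : Determines ν G (Spacelike d)) :
    Determines ν G (Directions d (⊤ : Subgroup (Equiv.Perm (Fin 1)))) :=
  h.map (measurable_singleDirection.comp measurable_inr) fun _ _ _ => rfl

variable [MeasurableConstSMul (Poincare d) X] [IsFiniteMeasure ν]
  [SMulInvariantMeasure (Poincare d) X ν]

theorem not_determines_directions (hd : 1 ≤ d) {x : Minkowski d}
    (hG : MulAction.stabilizer (Poincare d) x ≤ G) (hk : 1 ≤ k)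
    (S : Subgroup (Equiv.Perm (Fin k))) : ¬ Determines ν G (Directions d S) := by
  refine not_determines_of_scaling (κ := Fin d × ℤˣ)
    (g := fun a => lorentzAbout x (boost a.1 (a.2 : ℤ))) (c := Real.exp 1)
    (Q := fun a => nullSum a.1 a.2) (fun _ => hG (lorentzAbout_mem_stabilizer _ _))
    (fun _ => (measurePreserving_smul _ ν).conservative) (Real.one_lt_exp_iff.2 one_pos)
    (fun _ => measurable_nullSum _ _) (fun ⟨i, ε⟩ y => ?_)
    fun y => Prod.exists.2 (exists_nullSum_ne_zero hd hk y)
  rw [nullSum_boost_smul, ← Int.cast_mul, Int.units_coe_mul_self, Int.cast_one]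

theorem not_determines_timelike (hd : 1 ≤ d) {x : Minkowski d}
    (hG : MulAction.stabilizer (Poincare d) x ≤ G) : ¬ Determines ν G (Timelike d) :=
  fun h => not_determines_directions hd hG le_rfl ⊤ h.directions_of_timelike

theorem not_determines_spacelike (hd : 1 ≤ d) {x : Minkowski d}
    (hG : MulAction.stabilizer (Poincare d) x ≤ G) : ¬ Determines ν G (Spacelike d) :=
  fun h => not_determines_directions hd hG le_rfl ⊤ h.directions_of_spacelike

end Directions

end Sprinkling

end

theorem mainTheorem4_general (d : ℕ) (hd : 1 ≤ d) {X : Type} [MeasurableSpace X]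
    [MulAction (Poincare d) X] [MeasurableConstSMul (Poincare d) X] (μ : Measure X)
    [IsFiniteMeasure μ] [SMulInvariantMeasure (Poincare d) X μ] :
    (¬ Determines μ (⊤ : Subgroup (Poincare d)) (Minkowski d) ∧
      ¬ Determines μ (translations d) (Minkowski d)) ∧
    (¬ Determines μ (⊤ : Subgroup (Poincare d)) (Timelike d) ∧
      ¬ Determines μ (⊤ : Subgroup (Poincare d)) (Spacelike d) ∧
      ∀ k : ℕ, 1 ≤ k → ∀ S : Subgroup (Equiv.Perm (Fin k)),
        ¬ Determines μ (⊤ : Subgroup (Poincare d)) (Directions d S)) ∧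
    (∀ x : Minkowski d,
      ¬ Determines μ (MulAction.stabilizer (Poincare d) x) (Timelike d) ∧
      ¬ Determines μ (MulAction.stabilizer (Poincare d) x) (Spacelike d) ∧
      ∀ k : ℕ, 1 ≤ k → ∀ S : Subgroup (Equiv.Perm (Fin k)),
        ¬ Determines μ (MulAction.stabilizer (Poincare d) x) (Directions d S)) ∧
    (¬ Determines (μ.prod (volume : Measure (Minkowski d)))
        (⊤ : Subgroup (Poincare d)) (Timelike d) ∧
      ¬ Determines (μ.prod (volume : Measure (Minkowski d)))
        (⊤ : Subgroup (Poincare d)) (Spacelike d) ∧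
      ∀ k : ℕ, 1 ≤ k → ∀ S : Subgroup (Equiv.Perm (Fin k)),
        ¬ Determines (μ.prod (volume : Measure (Minkowski d)))
          (⊤ : Subgroup (Poincare d)) (Directions d S)) := by
  have hprod (x : Minkowski d) : MulAction.stabilizer (Poincare d) x ≤
      ⊤ ⊓ MulAction.stabilizer (Poincare d) x := le_inf le_top le_rfl
  refine ⟨⟨not_determines_location le_top, not_determines_location le_rfl⟩,
    ⟨not_determines_timelike (x := 0) hd le_top, not_determines_spacelike (x := 0) hd le_top,
      fun _ hk => not_determines_directions (x := 0) hd le_top hk⟩,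
    fun x => ⟨not_determines_timelike hd le_rfl, not_determines_spacelike hd le_rfl,
      fun _ hk => not_determines_directions hd le_rfl hk⟩,
    fun h => ?_, fun h => ?_, fun _ hk S h => ?_⟩ <;>
    obtain ⟨x, hx⟩ := h.exists_inf_stabilizer
  · exact not_determines_timelike hd (hprod x) hx
  · exact not_determines_spacelike hd (hprod x) hx
  · exact not_determines_directions hd (hprod x) hk S hx

theorem mainTheorem4 (d : ℕ) (hd : 1 ≤ d) (ρ : ℝ) (hρ : 0 < ρ)
    (μ : Measure (Omega d)) (hμ : IsPoisson ρ μ) :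
    -- no preferred location, for the Poincaré group and already for the translations
    (¬ Determines μ (⊤ : Subgroup (Poincare d)) (Minkowski d) ∧
      ¬ Determines μ (translations d) (Minkowski d)) ∧
    -- no preferred direction or finite family of directions, for the Poincaré group
    (¬ Determines μ (⊤ : Subgroup (Poincare d)) (Timelike d) ∧
      ¬ Determines μ (⊤ : Subgroup (Poincare d)) (Spacelike d) ∧
      ∀ k : ℕ, 1 ≤ k → ∀ S : Subgroup (Equiv.Perm (Fin k)),
        ¬ Determines μ (⊤ : Subgroup (Poincare d)) (Directions d S)) ∧
    -- none at a given point, for the Lorentz group that fixes this point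
    (∀ x : Minkowski d,
      ¬ Determines μ (MulAction.stabilizer (Poincare d) x) (Timelike d) ∧
      ¬ Determines μ (MulAction.stabilizer (Poincare d) x) (Spacelike d) ∧
      ∀ k : ℕ, 1 ≤ k → ∀ S : Subgroup (Equiv.Perm (Fin k)),
        ¬ Determines μ (MulAction.stabilizer (Poincare d) x) (Directions d S)) ∧
    -- none at a point that is moved along with the sprinkling, for the Poincaré group
    (¬ Determines (μ.prod (volume : Measure (Minkowski d)))
        (⊤ : Subgroup (Poincare d)) (Timelike d) ∧
      ¬ Determines (μ.prod (volume : Measure (Minkowski d)))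
        (⊤ : Subgroup (Poincare d)) (Spacelike d) ∧
      ∀ k : ℕ, 1 ≤ k → ∀ S : Subgroup (Equiv.Perm (Fin k)),
        ¬ Determines (μ.prod (volume : Measure (Minkowski d)))
          (⊤ : Subgroup (Poincare d)) (Directions d S)) := by
  have := hμ.isProbabilityMeasure
  have := hμ.smulInvariantMeasure
  exact mainTheorem4_general d hd μ
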